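/- Let $T$ be a finite quandle, with operation $\triangleright$. For $x\in T$ put $r(x)=|\{y\in T: x\triangleright y=x\}|$ and $c(x)=|\{y\in T: y\triangleright x=y\}|$, and for a subset $S\subset T$ that is a subquandle put $qp_{S\subset T}(s,t)=\sum_{x\in S}s^{r(x)}t^{c(x)}\in\mathbb{Z}[s,t]$. Let $K$ be an oriented link, given by an oriented link diagram on the sphere, where two diagrams represent the same link if they are related by finitely many Reidemeister moves (and isotopies of the diagram). Let $Q(K)$ be its knot quandle: it is generated by the arcs of a diagram, with one relation $z=x\triangleright y$ at each crossing, where $y$ is the over-arc and $x$, $z$ are the under-arcs to the right and to the left of $y$. Let $\mathrm{Hom}(Q(K),T)$ be the (finite) set of quandle homomorphisms $Q(K)\to T$. Then: 1. For every $f\in\mathrm{Hom}(Q(K),T)$ the image $\mathrm{Im}(f)$ is a subquandle of $T$. 2. The multiset $$\Phi_{qp}(K)=\{\,qp_{\mathrm{Im}(f)\subset T}(s,t) : f\in \mathrm{Hom}(Q(K),T)\,\}$$ is an invariant of the link $K$: any two diagrams of the same link give the same multiset. 3. For all $s_0,t_0\in\mathbb{Z}$ the Laurent polynomial $$\Phi_{qp}(K,s_0,t_0)=\sum_{f\in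 \mathrm{Hom}(Q(K),T)} z^{\,qp_{\mathrm{Im}(f)\subset T}(s_0,t_0)}\in\mathbb{Z}[z^{\pm1}]$$ is an invariant of the link $K$. It is a specialization of $\Phi_{qp}(K)$: it equals $\sum_{p\in\Phi_{qp}(K)}z^{p(s_0,t_0)}$, with multiplicities. 4. It generalizes the quandle counting invariant: $\Phi_{qp}(K,0,0)=|\mathrm{Hom}(Q(K),T)|$, a constant Laurent polynomial. -/

import Mathlib

open scoped Quandles

namespace LinkQuandle

/-! ### Quandle polynomials

Mathlib writes `x ◃ y` for the result of letting `x` act on `y`, so the right-handed operation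
`y ▷ x` is `x ◃ y`, and `y ▷⁻¹ x` is `x ◃⁻¹ y`. -/

/-- A subset of a quandle that is closed under the quandle operation and its inverse, that is,
a subset which is itself a quandle under the restricted operation. -/
def IsSubquandle {Q : Type*} [Quandle Q] (S : Set Q) : Prop :=
  ∀ x ∈ S, ∀ y ∈ S, x ◃ y ∈ S ∧ x ◃⁻¹ y ∈ S

/-- The row count `r(x) = |{y : x ▷ y = x}|`. -/
noncomputable def rowCount {Q : Type*} [Quandle Q] (x : Q) : ℕ :=
  Nat.card {y : Q // y ◃ x = x}

/-- The column count `c(x) = |{y : y ▷ x = y}|`. -/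
noncomputable def colCount {Q : Type*} [Quandle Q] (x : Q) : ℕ :=
  Nat.card {y : Q // x ◃ y = y}

/-- The subquandle polynomial `∑_{x ∈ S} s ^ r(x) * t ^ c(x)` of `S ⊆ Q`, where `r` and `c` are
computed in the whole of `Q`; the variable `s` is `X 0` and the variable `t` is `X 1`. -/
noncomputable def subquandlePolynomial {Q : Type*} [Quandle Q] [Finite Q] (S : Set Q) :
    MvPolynomial (Fin 2) ℤ :=
  ∑ x ∈ S.toFinite.toFinset,
    MvPolynomial.X 0 ^ rowCount x * MvPolynomial.X 1 ^ colCount x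

/-! ### Quandles given by generators and relations -/

/-- Formal words in the quandle operation and its inverse, with letters in `X`. -/
inductive QuandleWord (X : Type) : Type
  | of (x : X) : QuandleWord X
  | act (u v : QuandleWord X) : QuandleWord X
  | invAct (u v : QuandleWord X) : QuandleWord X

/-- The smallest congruence on words that contains the relations `r` and the quandle axioms. -/
inductive QuandleCongr {X : Type} (r : QuandleWord X → QuandleWord X → Prop) :
    QuandleWord X → QuandleWord X → Prop
  | rel {u v : QuandleWord X} (h : r u v) : QuandleCongr r u v
  | refl (u : QuandleWord X) : QuandleCongr r u u
  | symm {u v : QuandleWord X} (h : QuandleCongr r u v) : QuandleCongr r v u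
  | trans {u v w : QuandleWord X} (h : QuandleCongr r u v) (h' : QuandleCongr r v w) :
      QuandleCongr r u w
  | act {u u' v v' : QuandleWord X} (h : QuandleCongr r u u') (h' : QuandleCongr r v v') :
      QuandleCongr r (u.act v) (u'.act v')
  | invAct {u u' v v' : QuandleWord X} (h : QuandleCongr r u u') (h' : QuandleCongr r v v') :
      QuandleCongr r (u.invAct v) (u'.invAct v')
  | self_distrib (u v w : QuandleWord X) :
      QuandleCongr r (u.act (v.act w)) ((u.act v).act (u.act w))
  | left_inv (u v : QuandleWord X) : QuandleCongr r (u.invAct (u.act v)) v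
  | right_inv (u v : QuandleWord X) : QuandleCongr r (u.act (u.invAct v)) v
  | fix (u : QuandleWord X) : QuandleCongr r (u.act u) u

/-- The setoid of `QuandleCongr r`. -/
def quandleSetoid {X : Type} (r : QuandleWord X → QuandleWord X → Prop) :
    Setoid (QuandleWord X) where
  r := QuandleCongr r
  iseqv := ⟨QuandleCongr.refl, QuandleCongr.symm, QuandleCongr.trans⟩

/-- The quandle presented by the generators `X` and the relations `r`. -/
def PresentedQuandle {X : Type} (r : QuandleWord X → QuandleWord X → Prop) : Type :=
  Quotient (quandleSetoid r)

instance instQuandlePresentedQuandle {X : Type} (r : QuandleWord X → QuandleWord X → Prop) :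
    Quandle (PresentedQuandle r) where
  act := Quotient.map₂ QuandleWord.act fun _ _ h _ _ h' => QuandleCongr.act h h'
  invAct := Quotient.map₂ QuandleWord.invAct fun _ _ h _ _ h' => QuandleCongr.invAct h h'
  self_distrib {x y z} := by
    induction x using Quotient.inductionOn
    induction y using Quotient.inductionOn
    induction z using Quotient.inductionOn
    exact Quotient.sound (QuandleCongr.self_distrib _ _ _)
  left_inv x y := by
    induction x using Quotient.inductionOn
    induction y using Quotient.inductionOn
    exact Quotient.sound (QuandleCongr.left_inv _ _)
  right_inv x y := by
    induction x using Quotient.inductionOn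
    induction y using Quotient.inductionOn
    exact Quotient.sound (QuandleCongr.right_inv _ _)
  fix {x} := by
    induction x using Quotient.inductionOn
    exact Quotient.sound (QuandleCongr.fix _)

/-- The element of the presented quandle given by a word. -/
def PresentedQuandle.mk {X : Type} (r : QuandleWord X → QuandleWord X → Prop)
    (w : QuandleWord X) : PresentedQuandle r :=
  Quotient.mk (quandleSetoid r) w

/-- The element of the presented quandle given by a generator. -/
def PresentedQuandle.of {X : Type} (r : QuandleWord X → QuandleWord X → Prop) (x : X) :
    PresentedQuandle r :=
  PresentedQuandle.mk r (.of x)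

/-- A homomorphism out of a presented quandle is determined by its values on the generators. -/
theorem PresentedQuandle.hom_injective {X : Type} (r : QuandleWord X → QuandleWord X → Prop)
    (T : Type*) [Quandle T] :
    Function.Injective
      fun (f : PresentedQuandle r →◃ T) (x : X) => f (PresentedQuandle.of r x) := by
  intro f g h
  have key : ∀ w : QuandleWord X, f (PresentedQuandle.mk r w) = g (PresentedQuandle.mk r w) := by
    intro w
    induction w with
    | of x => exact congrFun h x
    | act u v hu hv =>
      have e : PresentedQuandle.mk r (u.act v) =
          PresentedQuandle.mk r u ◃ PresentedQuandle.mk r v := rfl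
      rw [e, ShelfHom.map_act, ShelfHom.map_act, hu, hv]
    | invAct u v hu hv =>
      have e : PresentedQuandle.mk r u ◃ PresentedQuandle.mk r (u.invAct v) =
          PresentedQuandle.mk r v :=
        Quotient.sound (s := quandleSetoid r) (QuandleCongr.right_inv u v)
      rw [← e, ShelfHom.map_act, ShelfHom.map_act, hu] at hv
      exact (Rack.left_cancel _).1 hv
  apply DFunLike.ext
  intro q
  induction q using Quotient.inductionOn
  exact key _

instance instFiniteHom {X : Type} [Finite X] (r : QuandleWord X → QuandleWord X → Prop)
    (T : Type*) [Quandle T] [Finite T] : Finite (PresentedQuandle r →◃ T) :=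
  Finite.of_injective _ (PresentedQuandle.hom_injective r T)

/-! ### Oriented link diagrams

A diagram is an oriented plane graph, with edges labelled by natural numbers.  Its vertices are
the crossings and some ordinary points of the curve. -/

/-- A vertex of an oriented link diagram.

* `corner a b`: an ordinary point of the curve, at which the edge `a` ends and the edge `b` starts.
* `crossing ε oi oo ui uo`: a crossing, positive if `ε = true` and negative if `ε = false`, at
  which the over-strand comes in along `oi` and leaves along `oo`, and the under-strand comes in
  along `ui` and leaves along `uo`. -/
inductive Vertex : Type
  | corner (a b : ℕ) : Vertex
  | crossing (ε : Bool) (oi oo ui uo : ℕ) : Vertex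

namespace Vertex

/-- The edges that end at a vertex. -/
def ins : Vertex → Multiset ℕ
  | corner a _ => {a}
  | crossing _ oi _ ui _ => {oi, ui}

/-- The edges that start at a vertex. -/
def outs : Vertex → Multiset ℕ
  | corner _ b => {b}
  | crossing _ _ oo _ uo => {oo, uo}

/-- Rename the edges that end at a vertex by `f`, and those that start there by `g`. -/
def rename (f g : ℕ → ℕ) : Vertex → Vertex
  | corner a b => corner (f a) (g b)
  | crossing ε oi oo ui uo => crossing ε (f oi) (g oo) (f ui) (g uo)

/-- The sides of edges that meet in the angles of a vertex; `(e, true)` is the left side of the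
edge `e` and `(e, false)` is its right side.

At a crossing of a strand `i → o` with a strand `i' → o'` that crosses it from right to left, the
outgoing and incoming ends follow each other counterclockwise in the order `o, o', i, i'`.  At a
positive crossing the under-strand crosses the over-strand from right to left, at a negative one
the over-strand crosses the under-strand from right to left. -/
def angles : Vertex → List ((ℕ × Bool) × (ℕ × Bool))
  | corner a b => [((a, true), (b, true)), ((a, false), (b, false))]
  | crossing true oi oo ui uo =>
      [((oo, true), (uo, false)), ((uo, true), (oi, true)),
        ((oi, false), (ui, true)), ((ui, false), (oo, false))]
  | crossing false oi oo ui uo =>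
      [((uo, true), (oo, false)), ((oo, true), (ui, true)),
        ((ui, false), (oi, true)), ((oi, false), (uo, false))]

end Vertex

/-- All edges that end at some vertex of `V`. -/
def allIns (V : Multiset Vertex) : Multiset ℕ := V.bind Vertex.ins

/-- All edges that start at some vertex of `V`. -/
def allOuts (V : Multiset Vertex) : Multiset ℕ := V.bind Vertex.outs

/-- The type of edges. -/
abbrev EdgeOf (V : Multiset Vertex) : Type := {e : ℕ // e ∈ allIns V}

/-- Two edges share a vertex. -/
def Incident (V : Multiset Vertex) (e e' : EdgeOf V) : Prop :=
  ∃ v ∈ V, e.1 ∈ v.ins + v.outs ∧ e'.1 ∈ v.ins + v.outs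

/-- Two sides of edges meet in an angle of some vertex, and so border the same region. -/
def SameAngle (V : Multiset Vertex) (x y : EdgeOf V × Bool) : Prop :=
  ∃ v ∈ V, ((x.1.1, x.2), (y.1.1, y.2)) ∈ v.angles

/-- The number of connected components of the underlying graph. -/
noncomputable def numPieces (V : Multiset Vertex) : ℕ := Nat.card (Quot (Incident V))

/-- The number of faces of the oriented closed surface in which the graph is cellularly embedded
by the cyclic orders at its vertices (one surface for each connected component): a face is a class
of sides of edges, where sides that meet in an angle are identified. -/
noncomputable def numFaces (V : Multiset Vertex) : ℕ := Nat.card (Quot (SameAngle V))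

/-- An oriented link diagram: every edge starts at exactly one vertex and ends at exactly one
vertex, and every connected component of the graph lies on the sphere, i.e. the Euler
characteristic `V - E + F` is twice the number of connected components. -/
structure LinkDiagram where
  /-- The crossings and corners. -/
  vertices : Multiset Vertex
  outs_eq_ins : allOuts vertices = allIns vertices
  nodup : (allIns vertices).Nodup
  planar : vertices.card + numFaces vertices =
    (allIns vertices).card + 2 * numPieces vertices

namespace LinkDiagram

/-- The defining relations of the knot quandle, whose generators are the edges of the diagram.
The edges of one arc are equal: nothing happens at a corner or along the over-strand of a crossing.
If `y` is the over-strand at a crossing and `x` and `z` are the parts of the under-strand to the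
right and to the left of it, then `z = x ▷ y`. -/
inductive Relator (D : LinkDiagram) :
    QuandleWord (EdgeOf D.vertices) → QuandleWord (EdgeOf D.vertices) → Prop
  | corner (a b : EdgeOf D.vertices) (h : Vertex.corner a b ∈ D.vertices) :
      Relator D (.of a) (.of b)
  | overArc (ε : Bool) (oi oo ui uo : EdgeOf D.vertices)
      (h : Vertex.crossing ε oi oo ui uo ∈ D.vertices) : Relator D (.of oi) (.of oo)
  | pos (oi oo ui uo : EdgeOf D.vertices)
      (h : Vertex.crossing true oi oo ui uo ∈ D.vertices) :
      Relator D (.of uo) (.act (.of oi) (.of ui))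
  | neg (oi oo ui uo : EdgeOf D.vertices)
      (h : Vertex.crossing false oi oo ui uo ∈ D.vertices) :
      Relator D (.of ui) (.act (.of oi) (.of uo))

/-- The knot quandle `Q(K)` of the link `K` with diagram `D`. -/
abbrev KnotQuandle (D : LinkDiagram) : Type := PresentedQuandle (Relator D)

instance instFiniteEdgeOf (V : Multiset Vertex) : Finite (EdgeOf V) :=
  (allIns V).toFinset.finite_toSet.subset (fun _ h => Multiset.mem_toFinset.2 h)

/-! ### Reidemeister moves -/

/-- A strand `i → m → o` runs through two crossings. This is the part of it at the first crossing
(`b = true`) or at the second one (`b = false`): the incoming and the outgoing edge there. -/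
def leg (b : Bool) (i m o : ℕ) : ℕ × ℕ := if b then (i, m) else (m, o)

/-- A crossing of sign `ε` with given incoming and outgoing edges of over- and under-strand. -/
def cross (ε : Bool) (o u : ℕ × ℕ) : Vertex :=
  .crossing ε o.1 o.2 u.1 u.2

/-- A kink with one crossing of sign `ε` in a strand `a → m → b`, which passes its crossing first
over and then under (`p = true`) or first under and then over (`p = false`). -/
def kink (ε p : Bool) (a m b : ℕ) : Multiset Vertex :=
  {cross ε (leg p a m b) (leg (!p) a m b)}

/-- A strand `a → m → b` passes over a strand `c → n → d`, first at a crossing of sign `ε` and then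
at one of sign `-ε`. The under-strand runs through the two crossings in the same order (`p = true`)
or in the opposite order (`p = false`). -/
def bigon (ε p : Bool) (a m b c n d : ℕ) : Multiset Vertex :=
  {cross ε (leg true a m b) (leg p c n d), cross (!ε) (leg false a m b) (leg (!p) c n d)}

/-- A triangle of three straight strands: the top strand `a₁ → m₁ → b₁`, the middle strand
`a₂ → m₂ → b₂` and the bottom strand `a₃ → m₃ → b₃`. The signs of the crossings top/middle,
top/bottom, middle/bottom are `x`, `y`, `z`. The top strand meets the middle strand before the
bottom strand if and only if `p = true`. For `p = true` the middle strand meets the top strand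
first if and only if `y = z`, and the bottom strand meets the top strand first if and only if
`x = z`; for `p = false` all orders are reversed. -/
def triangle (x y z p : Bool) (a₁ m₁ b₁ a₂ m₂ b₂ a₃ m₃ b₃ : ℕ) : Multiset Vertex :=
  let q := (p == (y == z))
  let s := (p == (x == z))
  {cross x (leg p a₁ m₁ b₁) (leg q a₂ m₂ b₂),
    cross y (leg (!p) a₁ m₁ b₁) (leg s a₃ m₃ b₃),
    cross z (leg (!q) a₂ m₂ b₂) (leg (!s) a₃ m₃ b₃)}

/-- The elementary moves between oriented link diagrams: renaming edges, inserting a corner in an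
edge (neither changes the picture), and the three Reidemeister moves in all oriented versions. -/
inductive Move : LinkDiagram → LinkDiagram → Prop
  | relabel (D D' : LinkDiagram) (σ : Equiv.Perm ℕ)
      (h : D'.vertices = D.vertices.map (Vertex.rename σ σ)) : Move D D'
  | subdivide (D D' : LinkDiagram) (e e' : ℕ) (he : e ∈ allIns D.vertices)
      (h : D'.vertices = Vertex.corner e' e ::ₘ
        D.vertices.map (Vertex.rename id (Function.update id e e'))) : Move D D'
  | reidemeister₁ (D D' : LinkDiagram) (R : Multiset Vertex) (ε p : Bool) (a m b : ℕ)
      (h : D.vertices = {Vertex.corner a b} + R)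
      (h' : D'.vertices = kink ε p a m b + R) : Move D D'
  | reidemeister₂ (D D' : LinkDiagram) (R : Multiset Vertex) (ε p : Bool) (a m b c n d : ℕ)
      (h : D.vertices = {Vertex.corner a b, Vertex.corner c d} + R)
      (h' : D'.vertices = bigon ε p a m b c n d + R) : Move D D'
  | reidemeister₃ (D D' : LinkDiagram) (R : Multiset Vertex) (x y z : Bool)
      (a₁ m₁ b₁ a₂ m₂ b₂ a₃ m₃ b₃ : ℕ)
      (h : D.vertices = triangle x y z true a₁ m₁ b₁ a₂ m₂ b₂ a₃ m₃ b₃ + R)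
      (h' : D'.vertices = triangle x y z false a₁ m₁ b₁ a₂ m₂ b₂ a₃ m₃ b₃ + R) : Move D D'

/-- Two diagrams represent the same oriented link if and only if they are joined by a finite
sequence of elementary moves and their inverses. -/
def SameLink : LinkDiagram → LinkDiagram → Prop := Relation.EqvGen Move

/-! ### The invariants -/

/-- The set with multiplicities `{qp_{Im f ⊂ T}(s, t) : f ∈ Hom(Q(K), T)}`. -/
noncomputable def subquandlePolynomialInvariant (D : LinkDiagram) (T : Type*) [Quandle T]
    [Finite T] : Multiset (MvPolynomial (Fin 2) ℤ) :=
  letI : Fintype (D.KnotQuandle →◃ T) := Fintype.ofFinite _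
  (Finset.univ : Finset (D.KnotQuandle →◃ T)).val.map
    fun f : D.KnotQuandle →◃ T => subquandlePolynomial (Set.range f)

/-- The Laurent polynomial `∑_f z ^ qp_{Im f ⊂ T}(s₀, t₀)` over `f ∈ Hom(Q(K), T)`. -/
noncomputable def specializedInvariant (D : LinkDiagram) (T : Type*) [Quandle T]
    [Finite T] (s₀ t₀ : ℤ) : LaurentPolynomial ℤ :=
  letI : Fintype (D.KnotQuandle →◃ T) := Fintype.ofFinite _
  ∑ f : D.KnotQuandle →◃ T,
    LaurentPolynomial.T (MvPolynomial.eval ![s₀, t₀] (subquandlePolynomial (Set.range f)))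

end LinkDiagram

end LinkQuandle

/-!
The invariants of a diagram `D` are computed from the homomorphisms `Q(D) → T` and their images.
They depend only on the isomorphism class of `Q(D)`: precomposing with an isomorphism is a bijection
between the sets of homomorphisms, and it does not change images
(`LinkDiagram.KnotQuandleIso.exists_equiv`). So it has to be shown that an elementary move does not
change the knot quandle up to isomorphism (`LinkDiagram.SameLink.knotQuandleIso`).

By its universal property, a homomorphism `Q(D) → Q` is a coloring of the edges of `D` by elements
of `Q` which satisfies the relation at every vertex (`IsColoring`, `LinkDiagram.lift`). A
Reidemeister move replaces a tangle `V` in `V + R` by a tangle `W`. The knot quandles of both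
diagrams are isomorphic if the colorings of `V` and those of `W`, in every quandle, correspond to
each other bijectively without a change of colors outside the tangles
(`LinkDiagram.KnotQuandleIso.of_coloringsExtend`): the generators of each knot quandle color its own
diagram, so they give a coloring of the other diagram, hence homomorphisms in both directions, and
these are inverse to each other because colorings of a tangle are determined by the colors of the
edges outside its interior.

To verify the condition for the three moves, the colors in each tangle are expressed by the colors
of the incoming edges. The moves then come down to the three axioms of a quandle: `x ◃ x = x`
(`LinkDiagram.isColoring_kink_iff`), invertibility of the action
(`LinkDiagram.isColoring_bigon_iff`) and self-distributivity (`LinkDiagram.bottomOutColor_not`).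

That the specialization at `(0, 0)` counts homomorphisms is due to `x ◃ x = x`, by which all
exponents `r(x)` are positive.
-/

namespace LinkQuandle

/-! ### Homomorphisms and signed actions of quandles -/

theorem map_invAct {Q Q' : Type*} [Rack Q] [Rack Q'] (f : Q →◃ Q') (x y : Q) :
    f (x ◃⁻¹ y) = f x ◃⁻¹ f y := by
  rw [← Rack.left_cancel (f x), ← ShelfHom.map_act, Rack.act_invAct_eq, Rack.act_invAct_eq]

theorem isSubquandle_range {Q Q' : Type*} [Quandle Q] [Quandle Q'] (f : Q →◃ Q') :
    IsSubquandle (Set.range f) := by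
  rintro _ ⟨x, rfl⟩ _ ⟨y, rfl⟩
  exact ⟨⟨x ◃ y, f.map_act⟩, ⟨x ◃⁻¹ y, map_invAct f x y⟩⟩

/-- The action of `x` on `y` if `ε = true`, and the inverse action if `ε = false`. This is the
effect on an under-strand of passing, in its own direction, a crossing of sign `ε`. -/
def signedAct {Q : Type*} [Quandle Q] (ε : Bool) (x y : Q) : Q :=
  if ε then x ◃ y else x ◃⁻¹ y

section signedAct

variable {Q : Type*} [Quandle Q]

@[simp]
theorem signedAct_self (ε : Bool) (x : Q) : signedAct ε x x = x := by
  cases ε <;> simp [signedAct]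

@[simp]
theorem signedAct_not_signedAct (ε : Bool) (x y : Q) :
    signedAct (!ε) x (signedAct ε x y) = y := by
  cases ε <;> simp [signedAct]

theorem eq_signedAct_iff (ε : Bool) (x y z : Q) :
    y = signedAct ε x z ↔ z = signedAct (!ε) x y := by
  constructor <;> rintro rfl
  · simp
  · simpa using (signedAct_not_signedAct (!ε) x y).symm

theorem signedAct_distrib (ε δ : Bool) (x y z : Q) :
    signedAct ε x (signedAct δ y z) = signedAct δ (signedAct ε x y) (signedAct ε x z) := by
  have key (δ : Bool) (y z : Q) :
      signedAct true x (signedAct δ y z) =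
        signedAct δ (signedAct true x y) (signedAct true x z) := by
    cases δ
    · have : (x ◃ y) ◃ x ◃ y ◃⁻¹ z = x ◃ z := by
        rw [← Rack.self_distrib, Rack.act_invAct_eq]
      simp [signedAct, ← this]
    · exact Rack.self_distrib
  cases ε
  · -- the inverse of an automorphism is an automorphism
    rw [← Rack.left_cancel x]
    have h := key δ (signedAct false x y) (signedAct false x z)
    simp only [signedAct, Bool.false_eq_true, if_true, if_false, Rack.act_invAct_eq] at h ⊢
    exact h.symm
  · exact key δ y z

end signedAct

/-! ### The universal property of a presented quandle -/

/-- The value of a word under an assignment of elements of a quandle to its letters. -/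
def QuandleWord.eval {X : Type} {Q : Type*} [Quandle Q] (g : X → Q) : QuandleWord X → Q
  | of x => g x
  | act u v => u.eval g ◃ v.eval g
  | invAct u v => u.eval g ◃⁻¹ v.eval g

theorem QuandleCongr.eval_eq {X : Type} {Q : Type*} [Quandle Q]
    {r : QuandleWord X → QuandleWord X → Prop} {g : X → Q}
    (hg : ∀ u v, r u v → u.eval g = v.eval g) {u v : QuandleWord X} (h : QuandleCongr r u v) :
    u.eval g = v.eval g := by
  induction h with
  | rel h => exact hg _ _ h
  | refl => rfl
  | symm _ ih => exact ih.symm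
  | trans _ _ ih ih' => exact ih.trans ih'
  | act _ _ ih ih' => simp [QuandleWord.eval, ih, ih']
  | invAct _ _ ih ih' => simp [QuandleWord.eval, ih, ih']
  | self_distrib => exact Shelf.self_distrib
  | left_inv => simp [QuandleWord.eval]
  | right_inv => simp [QuandleWord.eval]
  | fix => simp [QuandleWord.eval]

/-- The homomorphism out of a presented quandle with given values on the generators. -/
def PresentedQuandle.lift {X : Type} {Q : Type*} [Quandle Q]
    (r : QuandleWord X → QuandleWord X → Prop) (g : X → Q)
    (hg : ∀ u v, r u v → u.eval g = v.eval g) : PresentedQuandle r →◃ Q where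
  toFun := Quotient.lift (QuandleWord.eval g) fun _ _ h => QuandleCongr.eval_eq hg h
  map_act' {x y} := by
    induction x using Quotient.inductionOn
    induction y using Quotient.inductionOn
    rfl

theorem PresentedQuandle.hom_ext {X : Type} {r : QuandleWord X → QuandleWord X → Prop}
    {Q : Type*} [Quandle Q] {f g : PresentedQuandle r →◃ Q}
    (h : ∀ x, f (PresentedQuandle.of r x) = g (PresentedQuandle.of r x)) : f = g :=
  PresentedQuandle.hom_injective r Q (funext h)

/-! ### Colorings of diagrams -/

/-- The edges at a vertex are colored by elements of a quandle in accordance with the relations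
that the vertex contributes to the knot quandle. -/
def Vertex.IsColoredBy {Q : Type*} [Quandle Q] (c : ℕ → Q) : Vertex → Prop
  | corner a b => c a = c b
  | crossing ε oi oo ui uo => c oi = c oo ∧ c uo = signedAct ε (c oi) (c ui)

/-- The map `c` is a coloring of all the vertices of `V`. A color is assigned to every natural
number; only the colors of the edges of `V` matter. -/
def IsColoring {Q : Type*} [Quandle Q] (V : Multiset Vertex) (c : ℕ → Q) : Prop :=
  ∀ v ∈ V, v.IsColoredBy c

theorem isColoring_add {Q : Type*} [Quandle Q] {V W : Multiset Vertex} {c : ℕ → Q} :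
    IsColoring (V + W) c ↔ IsColoring V c ∧ IsColoring W c := by
  simp [IsColoring, or_imp, forall_and]

theorem Vertex.IsColoredBy.congr {Q : Type*} [Quandle Q] {c c' : ℕ → Q} {v : Vertex}
    (h : v.IsColoredBy c) (hc : ∀ e ∈ v.ins + v.outs, c' e = c e) : v.IsColoredBy c' := by
  cases v <;> simp_all [Vertex.ins, Vertex.outs, Vertex.IsColoredBy]

theorem Vertex.isColoredBy_rename {Q : Type*} [Quandle Q] {c d : ℕ → Q} {f g : ℕ → ℕ}
    (hf : ∀ e, c (f e) = d e) (hg : ∀ e, c (g e) = d e) (v : Vertex) :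
    (v.rename f g).IsColoredBy c ↔ v.IsColoredBy d := by
  cases v <;> simp [Vertex.rename, Vertex.IsColoredBy, hf, hg]

theorem IsColoring.map {Q Q' : Type*} [Quandle Q] [Quandle Q'] {V : Multiset Vertex} {c : ℕ → Q}
    (h : IsColoring V c) (f : Q →◃ Q') : IsColoring V (fun e => f (c e)) := by
  intro v hv
  have := h v hv
  cases v with
  | corner a b => exact congrArg f this
  | crossing ε oi oo ui uo =>
    refine ⟨congrArg f this.1, (congrArg f this.2).trans ?_⟩
    cases ε
    · exact map_invAct f _ _
    · exact f.map_act

theorem mem_allIns_of_mem_ins {V : Multiset Vertex} {v : Vertex} (hv : v ∈ V) {e : ℕ}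
    (he : e ∈ v.ins) : e ∈ allIns V :=
  Multiset.mem_bind.2 ⟨v, hv, he⟩

theorem mem_allOuts_of_mem_outs {V : Multiset Vertex} {v : Vertex} (hv : v ∈ V) {e : ℕ}
    (he : e ∈ v.outs) : e ∈ allOuts V :=
  Multiset.mem_bind.2 ⟨v, hv, he⟩

namespace LinkDiagram

theorem mem_allIns_of_mem_edges {D : LinkDiagram} {v : Vertex} (hv : v ∈ D.vertices) {e : ℕ}
    (he : e ∈ v.ins + v.outs) : e ∈ allIns D.vertices := by
  rcases Multiset.mem_add.1 he with he | he
  · exact mem_allIns_of_mem_ins hv he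
  · exact D.outs_eq_ins ▸ mem_allOuts_of_mem_outs hv he

theorem nodup_allOuts (D : LinkDiagram) : (allOuts D.vertices).Nodup :=
  D.outs_eq_ins ▸ D.nodup

/-- The homomorphism from the knot quandle that corresponds to a coloring. -/
def lift {Q : Type*} [Quandle Q] (D : LinkDiagram) (c : ℕ → Q) (hc : IsColoring D.vertices c) :
    D.KnotQuandle →◃ Q :=
  PresentedQuandle.lift _ (fun e => c e.1) <| by
    rintro _ _ (⟨a, b, h⟩ | ⟨ε, oi, oo, ui, uo, h⟩ | ⟨oi, oo, ui, uo, h⟩ | ⟨oi, oo, ui, uo, h⟩)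
    · exact hc _ h
    · exact (hc _ h).1
    · exact (hc _ h).2
    · have := (hc _ h).2
      rw [eq_signedAct_iff] at this
      exact this

@[simp]
theorem lift_of {Q : Type*} [Quandle Q] (D : LinkDiagram) (c : ℕ → Q)
    (hc : IsColoring D.vertices c) (e : EdgeOf D.vertices) :
    D.lift c hc (PresentedQuandle.of _ e) = c e.1 :=
  rfl

open Classical in
/-- The coloring of a nonempty diagram by the generators of its own knot quandle. Numbers that are
not edges get the color `q`. -/
noncomputable def universalColoring (D : LinkDiagram) (q : D.KnotQuandle) (e : ℕ) :
    D.KnotQuandle :=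
  if h : e ∈ allIns D.vertices then PresentedQuandle.of _ ⟨e, h⟩ else q

theorem universalColoring_of_mem (D : LinkDiagram) (q : D.KnotQuandle) {e : ℕ}
    (h : e ∈ allIns D.vertices) : D.universalColoring q e = PresentedQuandle.of _ ⟨e, h⟩ :=
  dif_pos h

theorem isColoring_universalColoring (D : LinkDiagram) (q : D.KnotQuandle) :
    IsColoring D.vertices (D.universalColoring q) := by
  have sound {u v : QuandleWord (EdgeOf D.vertices)} (h : D.Relator u v) :
      PresentedQuandle.mk D.Relator u = PresentedQuandle.mk D.Relator v :=
    Quotient.sound (s := quandleSetoid _) (QuandleCongr.rel h)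
  intro v hv
  have mem (e : ℕ) (he : e ∈ v.ins + v.outs) : e ∈ allIns D.vertices :=
    mem_allIns_of_mem_edges hv he
  cases v with
  | corner a b =>
    simp only [Vertex.ins, Vertex.outs, Multiset.mem_add, Multiset.mem_singleton] at mem
    have ha := mem a (by simp)
    have hb := mem b (by simp)
    simp only [Vertex.IsColoredBy, universalColoring_of_mem D q ha,
      universalColoring_of_mem D q hb]
    exact sound (.corner ⟨a, ha⟩ ⟨b, hb⟩ hv)
  | crossing ε oi oo ui uo =>
    simp only [Vertex.ins, Vertex.outs, Multiset.mem_add, Multiset.insert_eq_cons,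
      Multiset.mem_cons, Multiset.mem_singleton] at mem
    have hoi := mem oi (by simp)
    have hoo := mem oo (by simp)
    have hui := mem ui (by simp)
    have huo := mem uo (by simp)
    simp only [Vertex.IsColoredBy, universalColoring_of_mem D q hoi,
      universalColoring_of_mem D q hoo, universalColoring_of_mem D q hui,
      universalColoring_of_mem D q huo]
    refine ⟨sound (.overArc ε ⟨oi, hoi⟩ ⟨oo, hoo⟩ ⟨ui, hui⟩ ⟨uo, huo⟩ hv), ?_⟩
    cases ε
    · rw [eq_signedAct_iff]
      exact sound (.neg ⟨oi, hoi⟩ ⟨oo, hoo⟩ ⟨ui, hui⟩ ⟨uo, huo⟩ hv)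
    · exact sound (.pos ⟨oi, hoi⟩ ⟨oo, hoo⟩ ⟨ui, hui⟩ ⟨uo, huo⟩ hv)

/-! ### Isomorphic knot quandles -/

/-- The knot quandles of two diagrams are isomorphic. -/
def KnotQuandleIso (D D' : LinkDiagram) : Prop :=
  ∃ (φ : D.KnotQuandle →◃ D'.KnotQuandle) (ψ : D'.KnotQuandle →◃ D.KnotQuandle),
    (∀ x, ψ (φ x) = x) ∧ ∀ y, φ (ψ y) = y

theorem KnotQuandleIso.refl (D : LinkDiagram) : KnotQuandleIso D D :=
  ⟨ShelfHom.id _, ShelfHom.id _, fun _ => rfl, fun _ => rfl⟩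

theorem KnotQuandleIso.symm {D D' : LinkDiagram} (h : KnotQuandleIso D D') :
    KnotQuandleIso D' D :=
  let ⟨φ, ψ, h₁, h₂⟩ := h
  ⟨ψ, φ, h₂, h₁⟩

theorem KnotQuandleIso.trans {D D' D'' : LinkDiagram} (h : KnotQuandleIso D D')
    (h' : KnotQuandleIso D' D'') : KnotQuandleIso D D'' := by
  obtain ⟨φ, ψ, h₁, h₂⟩ := h
  obtain ⟨φ', ψ', h₁', h₂'⟩ := h'
  exact ⟨φ'.comp φ, ψ.comp ψ', by simp [h₁, h₁'], by simp [h₂, h₂']⟩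

/-- An isomorphism of knot quandles is given by a coloring of each diagram by the knot quandle of
the other one, if the induced homomorphisms are inverse to each other on the generators. -/
theorem KnotQuandleIso.of_colorings {D D' : LinkDiagram} {c' : ℕ → D'.KnotQuandle}
    {c : ℕ → D.KnotQuandle} (hc' : IsColoring D.vertices c') (hc : IsColoring D'.vertices c)
    (h : ∀ e : EdgeOf D.vertices, D'.lift c hc (c' e.1) = PresentedQuandle.of _ e)
    (h' : ∀ e : EdgeOf D'.vertices, D.lift c' hc' (c e.1) = PresentedQuandle.of _ e) :
    KnotQuandleIso D D' := by
  refine ⟨D.lift c' hc', D'.lift c hc, fun x => ?_, fun y => ?_⟩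
  · exact DFunLike.congr_fun (PresentedQuandle.hom_ext
      (f := (D'.lift c hc).comp (D.lift c' hc')) (g := ShelfHom.id _) h) x
  · exact DFunLike.congr_fun (PresentedQuandle.hom_ext
      (f := (D.lift c' hc').comp (D'.lift c hc)) (g := ShelfHom.id _) h') y

/-- Isomorphic knot quandles have corresponding homomorphisms to `T`, with the same images. -/
theorem KnotQuandleIso.exists_equiv {D D' : LinkDiagram} (h : KnotQuandleIso D D') (T : Type*)
    [Quandle T] :
    ∃ E : (D.KnotQuandle →◃ T) ≃ (D'.KnotQuandle →◃ T), ∀ f, Set.range (E f) = Set.range f := by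
  obtain ⟨φ, ψ, h₁, h₂⟩ := h
  refine ⟨⟨fun f => f.comp ψ, fun g => g.comp φ, fun f => ?_, fun g => ?_⟩, fun f => ?_⟩
  · exact DFunLike.ext _ _ fun x => congrArg f (h₁ x)
  · exact DFunLike.ext _ _ fun y => congrArg g (h₂ y)
  · exact Function.Surjective.range_comp (f := ψ) (fun x => ⟨φ x, h₁ x⟩) f

/-! ### The invariants of isomorphic knot quandles -/

theorem KnotQuandleIso.subquandlePolynomialInvariant_eq {D D' : LinkDiagram}
    (h : KnotQuandleIso D D') (T : Type*) [Quandle T] [Finite T] :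
    D.subquandlePolynomialInvariant T = D'.subquandlePolynomialInvariant T := by
  obtain ⟨E, hE⟩ := h.exists_equiv T
  let : Fintype (D.KnotQuandle →◃ T) := Fintype.ofFinite _
  let : Fintype (D'.KnotQuandle →◃ T) := Fintype.ofFinite _
  simp only [subquandlePolynomialInvariant]
  rw [← Multiset.map_univ_val_equiv E, Multiset.map_map]
  simp only [Function.comp_def, hE]

theorem specializedInvariant_eq_sum_map (D : LinkDiagram) (T : Type*) [Quandle T] [Finite T]
    (s₀ t₀ : ℤ) :
    D.specializedInvariant T s₀ t₀ =
      ((D.subquandlePolynomialInvariant T).map fun p =>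
        (LaurentPolynomial.T (MvPolynomial.eval ![s₀, t₀] p) : LaurentPolynomial ℤ)).sum := by
  simp only [specializedInvariant, subquandlePolynomialInvariant, Multiset.map_map]
  rfl

end LinkDiagram

/-- Since `x ◃ x = x`, every `r(x)` is positive, so the polynomial has no constant term. -/
theorem eval_zero_subquandlePolynomial {Q : Type*} [Quandle Q] [Finite Q] (S : Set Q) :
    MvPolynomial.eval ![0, 0] (subquandlePolynomial S) = 0 := by
  rw [subquandlePolynomial, map_sum]
  refine Finset.sum_eq_zero fun x _ => ?_
  have : Nonempty {y : Q // y ◃ x = x} := ⟨⟨x, Quandle.fix⟩⟩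
  have hr : rowCount x ≠ 0 := Nat.card_pos.ne'
  simp [hr]

theorem LinkDiagram.specializedInvariant_zero_zero (D : LinkDiagram) (T : Type*) [Quandle T]
    [Finite T] :
    D.specializedInvariant T 0 0 =
      LaurentPolynomial.C (Nat.card (D.KnotQuandle →◃ T) : ℤ) := by
  let : Fintype (D.KnotQuandle →◃ T) := Fintype.ofFinite _
  simp [specializedInvariant, eval_zero_subquandlePolynomial, Nat.card_eq_fintype_card]

/-! ### Replacing a part of a diagram -/

/-- Every coloring of the tangle `V` becomes a coloring of the tangle `W` by changing the colors of
the edges in `M` only, and a coloring of `W` is determined by the colors of its edges outside `M`.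
The set `M` consists of the edges in the interior of the two tangles. -/
structure ColoringsExtend (V W : Multiset Vertex) (M : Set ℕ) : Prop where
  exists_coloring : ∀ {Q : Type} [Quandle Q] (c : ℕ → Q), IsColoring V c →
    ∃ c', IsColoring W c' ∧ ∀ e ∉ M, c' e = c e
  unique : ∀ {Q : Type} [Quandle Q] (c c' : ℕ → Q), IsColoring W c → IsColoring W c' →
    (∀ e ∈ allIns W, e ∉ M → c e = c' e) → ∀ e ∈ allIns W, c e = c' e

theorem ColoringsExtend.exists_coloring_add {V W R : Multiset Vertex} {M : Set ℕ}
    (h : ColoringsExtend V W M) (hR : ∀ v ∈ R, ∀ e ∈ v.ins + v.outs, e ∉ M)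
    {U U' : Multiset Vertex} (hU : U = V + R) (hU' : U' = W + R) {Q : Type} [Quandle Q]
    {c : ℕ → Q} (hc : IsColoring U c) :
    ∃ c', IsColoring U' c' ∧ ∀ e ∉ M, c' e = c e := by
  subst hU hU'
  rw [isColoring_add] at hc
  obtain ⟨c', hc', hM⟩ := h.exists_coloring c hc.1
  exact ⟨c', isColoring_add.2 ⟨hc', fun v hv => (hc.2 v hv).congr fun e he => hM e (hR v hv e he)⟩,
    hM⟩

theorem ColoringsExtend.unique_add {V W R : Multiset Vertex} {M : Set ℕ}
    (h : ColoringsExtend V W M) (hR : ∀ v ∈ R, ∀ e ∈ v.ins + v.outs, e ∉ M)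
    {U : Multiset Vertex} (hU : U = W + R) {Q : Type} [Quandle Q] {c c' : ℕ → Q}
    (hc : IsColoring U c) (hc' : IsColoring U c') (hM : ∀ e ∈ allIns U, e ∉ M → c e = c' e) :
    ∀ e ∈ allIns U, c e = c' e := by
  subst hU
  rw [isColoring_add] at hc hc'
  simp only [allIns, Multiset.add_bind, Multiset.mem_add] at hM ⊢
  rintro e (he | he)
  · exact h.unique c c' hc.1 hc'.1 (fun e he => hM e (.inl he)) e he
  · obtain ⟨v, hv, hev⟩ := Multiset.mem_bind.1 he
    exact hM e (.inr he) (hR v hv e (Multiset.mem_add.2 (.inl hev)))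

namespace LinkDiagram

/-- Replacing the tangle `V` by the tangle `W` does not change the knot quandle: the universal
colorings of the two diagrams are transported to each other. -/
theorem KnotQuandleIso.of_coloringsExtend {D D' : LinkDiagram} {V W R : Multiset Vertex}
    {M : Set ℕ} (hD : D.vertices = V + R) (hD' : D'.vertices = W + R)
    (hR : ∀ v ∈ R, ∀ e ∈ v.ins + v.outs, e ∉ M)
    (hVW : ∀ e ∉ M, e ∈ allIns V ↔ e ∈ allIns W)
    (h : ColoringsExtend V W M) (h' : ColoringsExtend W V M) (hV : ∃ e, e ∈ allIns V)
    (hW : ∃ e, e ∈ allIns W) : KnotQuandleIso D D' := by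
  have hedges (e : ℕ) (he : e ∉ M) : e ∈ allIns D.vertices ↔ e ∈ allIns D'.vertices := by
    simp only [hD, hD', allIns, Multiset.add_bind, Multiset.mem_add] at hVW ⊢
    rw [hVW e he]
  obtain ⟨e₀, he₀⟩ := hV
  obtain ⟨e₁, he₁⟩ := hW
  have q : D.KnotQuandle := PresentedQuandle.of _
    ⟨e₀, by rw [hD]; simp only [allIns, Multiset.add_bind, Multiset.mem_add]; exact .inl he₀⟩
  have q' : D'.KnotQuandle := PresentedQuandle.of _
    ⟨e₁, by rw [hD']; simp only [allIns, Multiset.add_bind, Multiset.mem_add]; exact .inl he₁⟩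
  have hu := D.isColoring_universalColoring q
  have hu' := D'.isColoring_universalColoring q'
  obtain ⟨c', hc', hcM'⟩ := h'.exists_coloring_add hR hD' hD hu'
  obtain ⟨c, hc, hcM⟩ := h.exists_coloring_add hR hD hD' hu
  refine KnotQuandleIso.of_colorings hc' hc (fun e => ?_) fun e => ?_
  · rw [← universalColoring_of_mem D q e.2]
    refine h'.unique_add hR hD (hc'.map (D'.lift c hc)) hu
      (fun e he heM => ?_) e.1 e.2
    rw [hcM' e heM, universalColoring_of_mem D' q' ((hedges e heM).1 he), lift_of, hcM e heM]
  · rw [← universalColoring_of_mem D' q' e.2]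
    refine h.unique_add hR hD' (hc.map (D.lift c' hc')) hu'
      (fun e he heM => ?_) e.1 e.2
    rw [hcM e heM, universalColoring_of_mem D q ((hedges e heM).2 he), lift_of, hcM' e heM]

/-- In a diagram `V + R`, an edge that starts and ends in `V` does not occur in `R`. -/
theorem notMem_edges_of_mem {D : LinkDiagram} {V R : Multiset Vertex}
    (hD : D.vertices = V + R) {e : ℕ} (hi : e ∈ allIns V) (ho : e ∈ allOuts V) {v : Vertex}
    (hv : v ∈ R) : e ∉ v.ins + v.outs := by
  have hn := D.nodup
  have hn' := D.nodup_allOuts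
  rw [hD, allIns, Multiset.add_bind, Multiset.nodup_add] at hn
  rw [hD, allOuts, Multiset.add_bind, Multiset.nodup_add] at hn'
  rw [Multiset.mem_add]
  rintro (he | he)
  · exact Multiset.disjoint_left.1 hn.2.2 hi (mem_allIns_of_mem_ins hv he)
  · exact Multiset.disjoint_left.1 hn'.2.2 ho (mem_allOuts_of_mem_outs hv he)

theorem nodup_allIns_of_add {D : LinkDiagram} {V R : Multiset Vertex}
    (hD : D.vertices = V + R) : (allIns V).Nodup := by
  have hn := D.nodup
  rw [hD, allIns, Multiset.add_bind, Multiset.nodup_add] at hn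
  exact hn.1

theorem nodup_allOuts_of_add {D : LinkDiagram} {V R : Multiset Vertex}
    (hD : D.vertices = V + R) : (allOuts V).Nodup := by
  have hn := D.nodup_allOuts
  rw [hD, allOuts, Multiset.add_bind, Multiset.nodup_add] at hn
  exact hn.1

/-! ### The first Reidemeister move -/

theorem allIns_corner (a b : ℕ) : allIns {.corner a b} = {a} := by
  simp [allIns, Vertex.ins]

theorem allIns_kink (ε p : Bool) (a m b : ℕ) : allIns (kink ε p a m b) = {a, m} := by
  cases p
  · simpa [kink, cross, leg, allIns, Vertex.ins] using Multiset.pair_comm _ _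
  · simp [kink, cross, leg, allIns, Vertex.ins]

theorem allOuts_kink (ε p : Bool) (a m b : ℕ) : allOuts (kink ε p a m b) = {m, b} := by
  cases p
  · simpa [kink, cross, leg, allOuts, Vertex.outs] using Multiset.pair_comm _ _
  · simp [kink, cross, leg, allOuts, Vertex.outs]

theorem isColoring_corner_iff {Q : Type*} [Quandle Q] {c : ℕ → Q} {a b : ℕ} :
    IsColoring {.corner a b} c ↔ c b = c a := by
  simp [IsColoring, Vertex.IsColoredBy, eq_comm]

/-- As the strand crosses itself, all edges of a kink have the same color. -/
theorem isColoring_kink_iff {Q : Type*} [Quandle Q] {c : ℕ → Q} {ε p : Bool} {a m b : ℕ} :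
    IsColoring (kink ε p a m b) c ↔ c m = c a ∧ c b = c a := by
  cases p
  · simp only [IsColoring, kink, cross, leg, Multiset.mem_singleton, forall_eq,
      Vertex.IsColoredBy, Bool.not_false, Bool.false_eq_true, if_true, if_false]
    constructor
    · rintro ⟨h, h'⟩
      rw [eq_signedAct_iff, signedAct_self] at h'
      exact ⟨h'.symm, h ▸ h'.symm⟩
    · rintro ⟨h, h'⟩
      simp [h, h']
  · simp only [IsColoring, kink, cross, leg, Multiset.mem_singleton, forall_eq,
      Vertex.IsColoredBy, Bool.not_true, Bool.false_eq_true, if_true, if_false]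
    constructor
    · rintro ⟨h, h'⟩
      rw [← h, signedAct_self] at h'
      exact ⟨h.symm, h'⟩
    · rintro ⟨h, h'⟩
      simp [h, h']

theorem knotQuandleIso_reidemeister₁ {D D' : LinkDiagram} {R : Multiset Vertex} {ε p : Bool}
    {a m b : ℕ} (h : D.vertices = {Vertex.corner a b} + R)
    (h' : D'.vertices = kink ε p a m b + R) : KnotQuandleIso D D' := by
  have hi := nodup_allIns_of_add h'
  have ho := nodup_allOuts_of_add h'
  simp only [allIns_kink, allOuts_kink, Multiset.insert_eq_cons, Multiset.nodup_cons,
    Multiset.mem_singleton, Multiset.nodup_singleton, and_true] at hi ho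
  refine KnotQuandleIso.of_coloringsExtend (M := {m}) h h' ?_ ?_ ⟨?_, ?_⟩ ⟨?_, ?_⟩
    ⟨a, by simp [allIns_corner]⟩ ⟨a, by simp [allIns_kink]⟩
  · rintro v hv e he rfl
    exact notMem_edges_of_mem h' (by simp [allIns_kink]) (by simp [allOuts_kink]) hv he
  · intro e he
    simp_all [allIns_corner, allIns_kink]
  · intro Q _ c hc
    rw [isColoring_corner_iff] at hc
    refine ⟨Function.update c m (c a), isColoring_kink_iff.2 ?_, fun e he => ?_⟩
    · simp [Function.update_of_ne hi, Function.update_of_ne (Ne.symm ho), hc]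
    · exact Function.update_of_ne he _ _
  · intro Q _ c c' hc hc' hM
    rw [isColoring_kink_iff] at hc hc'
    simp_all [allIns_kink]
  · intro Q _ c hc
    rw [isColoring_kink_iff] at hc
    exact ⟨c, isColoring_corner_iff.2 hc.2, fun _ _ => rfl⟩
  · intro Q _ c c' _ _ hM
    simp_all [allIns_corner]

/-! ### The second Reidemeister move -/

theorem allIns_corners (a b c d : ℕ) : allIns {.corner a b, .corner c d} = {a, c} := by
  simp [allIns, Vertex.ins]

theorem allIns_bigon (ε p : Bool) (a m b c n d : ℕ) :
    allIns (bigon ε p a m b c n d) = {a, m, c, n} := by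
  simp only [bigon, allIns, Multiset.insert_eq_cons, Multiset.cons_bind, Multiset.singleton_bind]
  simp only [← Multiset.singleton_add, cross, Vertex.ins, Multiset.insert_eq_cons]
  cases p <;> simp only [leg, Bool.not_false, Bool.not_true, Bool.false_eq_true, if_true,
    if_false] <;> abel

theorem allOuts_bigon (ε p : Bool) (a m b c n d : ℕ) :
    allOuts (bigon ε p a m b c n d) = {m, b, n, d} := by
  simp only [bigon, allOuts, Multiset.insert_eq_cons, Multiset.cons_bind, Multiset.singleton_bind]
  simp only [← Multiset.singleton_add, cross, Vertex.outs, Multiset.insert_eq_cons]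
  cases p <;> simp only [leg, Bool.not_false, Bool.not_true, Bool.false_eq_true, if_true,
    if_false] <;> abel

theorem isColoring_corners_iff {Q : Type*} [Quandle Q] {k : ℕ → Q} {a b c d : ℕ} :
    IsColoring {.corner a b, .corner c d} k ↔ k b = k a ∧ k d = k c := by
  simp [IsColoring, Vertex.IsColoredBy, eq_comm]

/-- The second crossing undoes the effect of the first one on the under-strand. The first crossing
that the under-strand meets has sign `ε` if `p = true` and the opposite sign if `p = false`. -/
theorem isColoring_bigon_iff {Q : Type*} [Quandle Q] {k : ℕ → Q} {ε p : Bool}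
    {a m b c n d : ℕ} :
    IsColoring (bigon ε p a m b c n d) k ↔
      k m = k a ∧ k b = k a ∧ k n = signedAct (if p then ε else !ε) (k a) (k c) ∧
        k d = k c := by
  cases p
  · simp only [IsColoring, bigon, cross, leg, Multiset.insert_eq_cons, Multiset.mem_cons,
      Multiset.mem_singleton, forall_eq_or_imp, forall_eq, Vertex.IsColoredBy, Bool.not_false,
      Bool.false_eq_true, if_true, if_false]
    constructor
    · rintro ⟨⟨h₁, h₂⟩, h₃, h₄⟩
      rw [← h₁] at h₃ h₄
      refine ⟨h₁.symm, h₃.symm, h₄, ?_⟩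
      rw [h₂, h₄]
      simpa using signedAct_not_signedAct (!ε) (k a) (k c)
    · rintro ⟨h₁, h₂, h₃, h₄⟩
      refine ⟨⟨h₁.symm, ?_⟩, h₁.trans h₂.symm, by rw [h₃, h₁]⟩
      rw [h₃, h₄]
      simpa using (signedAct_not_signedAct (!ε) (k a) (k c)).symm
  · simp only [IsColoring, bigon, cross, leg, Multiset.insert_eq_cons, Multiset.mem_cons,
      Multiset.mem_singleton, forall_eq_or_imp, forall_eq, Vertex.IsColoredBy, Bool.not_true,
      Bool.false_eq_true, if_true, if_false]
    constructor
    · rintro ⟨⟨h₁, h₂⟩, h₃, h₄⟩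
      refine ⟨h₁.symm, h₃ ▸ h₁.symm, h₂, ?_⟩
      rw [h₄, h₂, ← h₁, signedAct_not_signedAct]
    · rintro ⟨h₁, h₂, h₃, h₄⟩
      refine ⟨⟨h₁.symm, h₃⟩, h₁.trans h₂.symm, ?_⟩
      rw [h₁, h₃, h₄, signedAct_not_signedAct]

theorem knotQuandleIso_reidemeister₂ {D D' : LinkDiagram} {R : Multiset Vertex} {ε p : Bool}
    {a m b c n d : ℕ} (h : D.vertices = {Vertex.corner a b, Vertex.corner c d} + R)
    (h' : D'.vertices = bigon ε p a m b c n d + R) : KnotQuandleIso D D' := by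
  have hi := nodup_allIns_of_add h'
  have ho := nodup_allOuts_of_add h'
  simp only [allIns_bigon, allOuts_bigon, Multiset.insert_eq_cons, Multiset.nodup_cons,
    Multiset.mem_cons, Multiset.mem_singleton, Multiset.nodup_singleton, and_true,
    not_or] at hi ho
  obtain ⟨⟨ham, -, han⟩, ⟨hmc, hmn⟩, hcn⟩ := hi
  obtain ⟨⟨hmb, -, hmd⟩, ⟨hbn, -⟩, hnd⟩ := ho
  refine KnotQuandleIso.of_coloringsExtend (M := {m, n}) h h' ?_ ?_ ⟨?_, ?_⟩ ⟨?_, ?_⟩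
    ⟨a, by rw [allIns_corners]; simp⟩ ⟨a, by simp [allIns_bigon]⟩
  · rintro v hv e he (rfl | rfl) <;>
      exact notMem_edges_of_mem h' (by simp [allIns_bigon]) (by simp [allOuts_bigon]) hv he
  · intro e he
    rw [allIns_corners, allIns_bigon]
    simp_all
  · intro Q _ k hk
    rw [isColoring_corners_iff] at hk
    refine ⟨Function.update (Function.update k m (k a)) n
      (signedAct (if p then ε else !ε) (k a) (k c)), isColoring_bigon_iff.2 ?_, fun e he => ?_⟩
    · simp [ham, han, hmn, hcn, Ne.symm hmb, hbn, Ne.symm hmd,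
        Ne.symm hnd, Ne.symm hmc, hk]
    · simp only [Set.mem_insert_iff, Set.mem_singleton_iff, not_or] at he
      simp [he]
  · intro Q _ k k' hk hk' hM
    rw [isColoring_bigon_iff] at hk hk'
    have ha := hM a (by simp [allIns_bigon]) (by simp [ham, han])
    have hc := hM c (by simp [allIns_bigon]) (by simp [Ne.symm hmc, hcn])
    simp [allIns_bigon, hk, hk', ha, hc]
  · intro Q _ k hk
    rw [isColoring_bigon_iff] at hk
    exact ⟨k, isColoring_corners_iff.2 ⟨hk.2.1, hk.2.2.2⟩, fun _ _ => rfl⟩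
  · intro Q _ k k' _ _ hM
    have ha := hM a (by rw [allIns_corners]; simp) (by simp [ham, han])
    have hc := hM c (by rw [allIns_corners]; simp) (by simp [Ne.symm hmc, hcn])
    rw [allIns_corners]
    simp [ha, hc]

/-! ### The third Reidemeister move -/

theorem allIns_triangle (x y z p : Bool) (a₁ m₁ b₁ a₂ m₂ b₂ a₃ m₃ b₃ : ℕ) :
    allIns (triangle x y z p a₁ m₁ b₁ a₂ m₂ b₂ a₃ m₃ b₃) = {a₁, m₁, a₂, m₂, a₃, m₃} := by
  simp only [triangle, allIns, Multiset.insert_eq_cons, Multiset.cons_bind,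
    Multiset.singleton_bind]
  simp only [← Multiset.singleton_add, cross, Vertex.ins, Multiset.insert_eq_cons]
  generalize (p == (y == z)) = q
  generalize (p == (x == z)) = s
  cases p <;> cases q <;> cases s <;> simp only [leg, Bool.not_false, Bool.not_true,
    Bool.false_eq_true, if_true, if_false] <;> abel

theorem allOuts_triangle (x y z p : Bool) (a₁ m₁ b₁ a₂ m₂ b₂ a₃ m₃ b₃ : ℕ) :
    allOuts (triangle x y z p a₁ m₁ b₁ a₂ m₂ b₂ a₃ m₃ b₃) = {m₁, b₁, m₂, b₂, m₃, b₃} := by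
  simp only [triangle, allOuts, Multiset.insert_eq_cons, Multiset.cons_bind,
    Multiset.singleton_bind]
  simp only [← Multiset.singleton_add, cross, Vertex.outs, Multiset.insert_eq_cons]
  generalize (p == (y == z)) = q
  generalize (p == (x == z)) = s
  cases p <;> cases q <;> cases s <;> simp only [leg, Bool.not_false, Bool.not_true,
    Bool.false_eq_true, if_true, if_false] <;> abel

/-- The color of the middle edge of the middle strand in a triangle, given the colors of the
incoming edges of the top strand and the middle strand. -/
def middleColor {Q : Type*} [Quandle Q] (x y z p : Bool) (t u : Q) : Q :=
  if p == (y == z) then signedAct x t u else u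

/-- The color of the middle edge of the bottom strand in a triangle, given the colors of the
three incoming edges. -/
def bottomColor {Q : Type*} [Quandle Q] (x y z p : Bool) (t u w : Q) : Q :=
  if p == (x == z) then signedAct y t w else signedAct z (middleColor x y z p t u) w

/-- The color of the outgoing edge of the bottom strand in a triangle, given the colors of the
three incoming edges. -/
def bottomOutColor {Q : Type*} [Quandle Q] (x y z p : Bool) (t u w : Q) : Q :=
  if p == (x == z) then signedAct z (middleColor x y z p t u) (signedAct y t w)
  else signedAct y t (signedAct z (middleColor x y z p t u) w)

/-- Both sides of the third Reidemeister move have the same effect on the bottom strand. This is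
the self-distributivity of the quandle operation. -/
theorem bottomOutColor_not {Q : Type*} [Quandle Q] (x y z p : Bool) (t u w : Q) :
    bottomOutColor x y z (!p) t u w = bottomOutColor x y z p t u w := by
  -- the top strand passes over the crossing of the middle strand with the bottom strand, at which
  -- the middle strand has the color `u` on one side of the top strand and `signedAct x t u` on the
  -- other side
  have h₁ := signedAct_distrib y z t u w
  have h₂ := signedAct_distrib y z t (signedAct x t u) w
  have h₃ := signedAct_not_signedAct x t u
  cases x <;> cases y <;> cases z <;> cases p <;> grind [bottomOutColor, middleColor]

theorem isColoring_triangle_iff {Q : Type*} [Quandle Q] {c : ℕ → Q} {x y z p : Bool}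
    {a₁ m₁ b₁ a₂ m₂ b₂ a₃ m₃ b₃ : ℕ} :
    IsColoring (triangle x y z p a₁ m₁ b₁ a₂ m₂ b₂ a₃ m₃ b₃) c ↔
      (c m₁ = c a₁ ∧ c m₂ = middleColor x y z p (c a₁) (c a₂) ∧
        c m₃ = bottomColor x y z p (c a₁) (c a₂) (c a₃)) ∧
      c b₁ = c a₁ ∧ c b₂ = signedAct x (c a₁) (c a₂) ∧
        c b₃ = bottomOutColor x y z p (c a₁) (c a₂) (c a₃) := by
  simp only [triangle, middleColor, bottomColor, bottomOutColor]
  generalize (p == (y == z)) = q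
  generalize (p == (x == z)) = s
  cases p <;> cases q <;> cases s <;>
    simp only [IsColoring, cross, leg, Multiset.insert_eq_cons, Multiset.mem_cons,
      Multiset.mem_singleton, forall_eq_or_imp, forall_eq, Vertex.IsColoredBy, Bool.not_false,
      Bool.not_true, Bool.false_eq_true, if_true, if_false] <;> grind

theorem coloringsExtend_triangle (x y z p : Bool) {a₁ m₁ b₁ a₂ m₂ b₂ a₃ m₃ b₃ : ℕ}
    (hi : ({a₁, m₁, a₂, m₂, a₃, m₃} : Multiset ℕ).Nodup)
    (ho : ({m₁, b₁, m₂, b₂, m₃, b₃} : Multiset ℕ).Nodup) :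
    ColoringsExtend (triangle x y z p a₁ m₁ b₁ a₂ m₂ b₂ a₃ m₃ b₃)
      (triangle x y z (!p) a₁ m₁ b₁ a₂ m₂ b₂ a₃ m₃ b₃) {m₁, m₂, m₃} := by
  simp only [Multiset.insert_eq_cons, Multiset.nodup_cons, Multiset.mem_cons,
    Multiset.mem_singleton, Multiset.nodup_singleton, and_true, not_or] at hi ho
  refine ⟨?_, ?_⟩
  · intro Q _ c hc
    rw [isColoring_triangle_iff] at hc
    let c' : ℕ → Q := fun e =>
      if e = m₁ then c a₁
      else if e = m₂ then middleColor x y z (!p) (c a₁) (c a₂)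
      else if e = m₃ then bottomColor x y z (!p) (c a₁) (c a₂) (c a₃)
      else c e
    have hc' (e : ℕ) (h₁ : e ≠ m₁) (h₂ : e ≠ m₂) (h₃ : e ≠ m₃) : c' e = c e := by
      simp [c', h₁, h₂, h₃]
    refine ⟨c', isColoring_triangle_iff.2 ?_, fun e he => ?_⟩
    · rw [hc' a₁, hc' a₂, hc' a₃, hc' b₁, hc' b₂, hc' b₃, bottomOutColor_not]
      · refine ⟨⟨?_, ?_, ?_⟩, hc.2⟩ <;> grind
      all_goals grind
    · simp only [Set.mem_insert_iff, Set.mem_singleton_iff, not_or] at he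
      exact hc' e he.1 he.2.1 he.2.2
  · intro Q _ c c' hc hc' hM
    rw [isColoring_triangle_iff] at hc hc'
    have h₁ := hM a₁ (by simp [allIns_triangle]) (by simp; grind)
    have h₂ := hM a₂ (by simp [allIns_triangle]) (by simp; grind)
    have h₃ := hM a₃ (by simp [allIns_triangle]) (by simp; grind)
    simp [allIns_triangle, hc.1, hc'.1, h₁, h₂, h₃]

theorem knotQuandleIso_reidemeister₃ {D D' : LinkDiagram} {R : Multiset Vertex} {x y z : Bool}
    {a₁ m₁ b₁ a₂ m₂ b₂ a₃ m₃ b₃ : ℕ}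
    (h : D.vertices = triangle x y z true a₁ m₁ b₁ a₂ m₂ b₂ a₃ m₃ b₃ + R)
    (h' : D'.vertices = triangle x y z false a₁ m₁ b₁ a₂ m₂ b₂ a₃ m₃ b₃ + R) :
    KnotQuandleIso D D' := by
  have hi := nodup_allIns_of_add h
  have ho := nodup_allOuts_of_add h
  rw [allIns_triangle] at hi
  rw [allOuts_triangle] at ho
  refine KnotQuandleIso.of_coloringsExtend h h' ?_ ?_
    (coloringsExtend_triangle x y z true hi ho) (coloringsExtend_triangle x y z false hi ho)
    ⟨a₁, by simp [allIns_triangle]⟩ ⟨a₁, by simp [allIns_triangle]⟩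
  · rintro v hv e he (rfl | rfl | rfl) <;>
      exact notMem_edges_of_mem h (by simp [allIns_triangle]) (by simp [allOuts_triangle]) hv he
  · simp [allIns_triangle]

/-! ### Relabeling and subdivision -/

theorem allIns_map_rename (V : Multiset Vertex) (f g : ℕ → ℕ) :
    allIns (V.map (Vertex.rename f g)) = (allIns V).map f := by
  have (v : Vertex) : (v.rename f g).ins = v.ins.map f := by
    cases v <;> simp [Vertex.rename, Vertex.ins]
  simp [allIns, Multiset.bind_map, Multiset.map_bind, this]

theorem isColoring_map_rename {Q : Type*} [Quandle Q] {V : Multiset Vertex} {c d : ℕ → Q}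
    {f g : ℕ → ℕ} (hf : ∀ e, c (f e) = d e) (hg : ∀ e, c (g e) = d e) :
    IsColoring (V.map (Vertex.rename f g)) c ↔ IsColoring V d := by
  simp [IsColoring, Vertex.isColoredBy_rename hf hg]

theorem eq_zero_of_allIns_eq_zero {V : Multiset Vertex} (h : ∀ e, e ∉ allIns V) : V = 0 := by
  refine Multiset.eq_zero_of_forall_notMem fun v hv => ?_
  cases v with
  | corner a b => exact h a (mem_allIns_of_mem_ins hv (by simp [Vertex.ins]))
  | crossing ε oi oo ui uo => exact h oi (mem_allIns_of_mem_ins hv (by simp [Vertex.ins]))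

theorem knotQuandleIso_relabel {D D' : LinkDiagram} {σ : Equiv.Perm ℕ}
    (h : D'.vertices = D.vertices.map (Vertex.rename σ σ)) : KnotQuandleIso D D' := by
  have hins : allIns D'.vertices = (allIns D.vertices).map σ := by rw [h, allIns_map_rename]
  have hmem (e : ℕ) : e ∈ allIns D.vertices ↔ σ e ∈ allIns D'.vertices := by simp [hins]
  by_cases hD : ∃ e, e ∈ allIns D.vertices
  · obtain ⟨e₀, he₀⟩ := hD
    have q : D.KnotQuandle := PresentedQuandle.of _ ⟨e₀, he₀⟩
    have q' : D'.KnotQuandle := PresentedQuandle.of _ ⟨σ e₀, (hmem e₀).1 he₀⟩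
    have hc' : IsColoring D.vertices (fun e => D'.universalColoring q' (σ e)) :=
      (isColoring_map_rename (fun _ => rfl) fun _ => rfl).1
        (h ▸ D'.isColoring_universalColoring q')
    have hc : IsColoring D'.vertices (fun e => D.universalColoring q (σ.symm e)) := by
      rw [h]
      exact (isColoring_map_rename (by simp) (by simp)).2 (D.isColoring_universalColoring q)
    refine KnotQuandleIso.of_colorings hc' hc (fun e => ?_) fun e => ?_
    · simp only [universalColoring_of_mem D' q' ((hmem e.1).1 e.2), lift_of,
        Equiv.symm_apply_apply, universalColoring_of_mem D q e.2]
    · have he : σ.symm e.1 ∈ allIns D.vertices := by simpa [hmem] using e.2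
      simp only [universalColoring_of_mem D q he, lift_of, Equiv.apply_symm_apply,
        universalColoring_of_mem D' q' e.2]
  · -- both diagrams are empty
    have hV := eq_zero_of_allIns_eq_zero (not_exists.1 hD)
    rw [hV, Multiset.map_zero, ← hV] at h
    have hDD' : D = D' := by
      cases D
      cases D'
      cases h
      rfl
    exact hDD' ▸ .refl D

theorem knotQuandleIso_subdivide {D D' : LinkDiagram} {e e' : ℕ} (he : e ∈ allIns D.vertices)
    (h : D'.vertices = Vertex.corner e' e ::ₘ
      D.vertices.map (Vertex.rename id (Function.update id e e'))) : KnotQuandleIso D D' := by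
  have hins : allIns D'.vertices = e' ::ₘ allIns D.vertices := by
    have := allIns_map_rename D.vertices id (Function.update id e e')
    rw [Multiset.map_id, allIns] at this
    rw [h, allIns, Multiset.cons_bind, this]
    rfl
  -- the new edge is not an edge of the old diagram
  have he' : e' ∉ allIns D.vertices := by
    have := D'.nodup
    rw [hins, Multiset.nodup_cons] at this
    exact this.1
  have hmem {i : ℕ} (hi : i ∈ allIns D.vertices) : i ∈ allIns D'.vertices := by simp [hins, hi]
  have hne : e ≠ e' := fun hee => he' (hee ▸ he)
  have q : D.KnotQuandle := PresentedQuandle.of _ ⟨e, he⟩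
  have q' : D'.KnotQuandle := PresentedQuandle.of _ ⟨e, hmem he⟩
  have hu' := D'.isColoring_universalColoring q'
  have hcorner : D'.universalColoring q' e' = D'.universalColoring q' e :=
    hu' (.corner e' e) (by simp [h])
  have hc' : IsColoring D.vertices (D'.universalColoring q') := by
    refine (isColoring_map_rename (fun _ => rfl) fun i => ?_).1
      fun v hv => hu' v (by rw [h]; exact Multiset.mem_cons_of_mem hv)
    by_cases hi : i = e
    · simp [hi, hcorner]
    · simp [hi]
  let c : ℕ → D.KnotQuandle :=
    Function.update (D.universalColoring q) e' (D.universalColoring q e)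
  have hc_of_mem {i : ℕ} (hi : i ∈ allIns D.vertices) : c i = D.universalColoring q i :=
    Function.update_of_ne (ne_of_mem_of_not_mem hi he') _ _
  have hc : IsColoring D'.vertices c := by
    intro v hv
    rw [h, Multiset.mem_cons] at hv
    rcases hv with rfl | hv
    · simp [Vertex.IsColoredBy, c, Function.update_of_ne hne]
    · refine (isColoring_map_rename (d := c) (fun _ => rfl) fun i => ?_).2 ?_ v hv
      · by_cases hi : i = e
        · simp [hi, c, Function.update_of_ne hne]
        · simp [hi]
      · exact fun w hw => (D.isColoring_universalColoring q w hw).congr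
          fun i hi => hc_of_mem (mem_allIns_of_mem_edges hw hi)
  refine KnotQuandleIso.of_colorings hc' hc (fun i => ?_) fun i => ?_
  · rw [universalColoring_of_mem D' q' (hmem i.2), lift_of, hc_of_mem i.2,
      universalColoring_of_mem D q i.2]
  · have hi : i.1 = e' ∨ i.1 ∈ allIns D.vertices := by
      rw [← Multiset.mem_cons, ← hins]
      exact i.2
    rw [← universalColoring_of_mem D' q' i.2]
    rcases hi with hi | hi
    · rw [hi, hcorner]
      simp [c, universalColoring_of_mem D q he]
    · rw [hc_of_mem hi, universalColoring_of_mem D q hi, lift_of]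

theorem SameLink.knotQuandleIso {D D' : LinkDiagram} (h : SameLink D D') :
    KnotQuandleIso D D' := by
  induction h with
  | rel D D' h =>
    cases h with
    | relabel _ h => exact knotQuandleIso_relabel h
    | subdivide _ _ he h => exact knotQuandleIso_subdivide he h
    | reidemeister₁ _ _ _ _ _ _ h h' => exact knotQuandleIso_reidemeister₁ h h'
    | reidemeister₂ _ _ _ _ _ _ _ _ _ h h' => exact knotQuandleIso_reidemeister₂ h h'
    | reidemeister₃ _ _ _ _ _ _ _ _ _ _ _ _ _ h h' =>
      exact knotQuandleIso_reidemeister₃ h h'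
  | refl D => exact .refl D
  | symm _ _ _ ih => exact ih.symm
  | trans _ _ _ _ _ ih ih' => exact ih.trans ih'

end LinkDiagram

end LinkQuandle

theorem mainTheorem6 {T : Type*} [Quandle T] [Finite T] :
    (∀ (D : LinkQuandle.LinkDiagram) (f : D.KnotQuandle →◃ T),
      LinkQuandle.IsSubquandle (Set.range f)) ∧
    (∀ D D' : LinkQuandle.LinkDiagram, D.SameLink D' →
      D.subquandlePolynomialInvariant T = D'.subquandlePolynomialInvariant T) ∧
    (∀ D D' : LinkQuandle.LinkDiagram, D.SameLink D' → ∀ s₀ t₀ : ℤ,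
      D.specializedInvariant T s₀ t₀ = D'.specializedInvariant T s₀ t₀) ∧
    (∀ (D : LinkQuandle.LinkDiagram) (s₀ t₀ : ℤ),
      D.specializedInvariant T s₀ t₀ =
        ((D.subquandlePolynomialInvariant T).map fun p =>
          (LaurentPolynomial.T (MvPolynomial.eval ![s₀, t₀] p) : LaurentPolynomial ℤ)).sum) ∧
    (∀ D : LinkQuandle.LinkDiagram,
      D.specializedInvariant T 0 0 =
        LaurentPolynomial.C (Nat.card (D.KnotQuandle →◃ T) : ℤ)) := by
  refine ⟨fun _ f => LinkQuandle.isSubquandle_range f,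
    fun _ _ h => h.knotQuandleIso.subquandlePolynomialInvariant_eq T, fun D D' h s₀ t₀ => ?_,
    fun D s₀ t₀ => D.specializedInvariant_eq_sum_map T s₀ t₀,
    fun D => D.specializedInvariant_zero_zero T⟩
  rw [D.specializedInvariant_eq_sum_map, D'.specializedInvariant_eq_sum_map,
    h.knotQuandleIso.subquandlePolynomialInvariant_eq T]
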